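/- Let $\mathbb{K}$ be a field and let $I \subsetneq \mathbb{K}[x,y]$ be a proper zero-dimensional ideal, i.e. $D = \dim_{\mathbb{K}} \mathbb{K}[x,y]/I$ is finite. Let $\preccurlyeq_{\mathrm{drl}}$ and $\preccurlyeq_{\mathrm{lex}}$ be the degree reverse lexicographic and the lexicographic orders with $x \prec y$, and write $\mathrm{lm}$ for $\preccurlyeq_{\mathrm{drl}}$-leading monomials. Let $(g_0,\ldots,g_{\ell-1})$ be a minimal $\preccurlyeq_{\mathrm{drl}}$-Gröbner basis of $I$ (not necessarily monic or reduced), sorted by increasing $\deg_y(\mathrm{lm}(g_i))$. Put $n_i = \deg_y(\mathrm{lm}(g_{i+1})) - \deg_y(\mathrm{lm}(g_i))$ for $0 \le i < \ell-1$, $n_{\ell-1} = \max\bigl(1, \max_{0\le i\le \ell-2}(n_i + \deg_y(g_i)) - \deg_y(g_{\ell-1})\bigr)$ and $n = n_0 + \cdots + n_{\ell-1}$. Let $M \in \mathbb{K}[x]^{n\times n}$ be the block-Toeplitz matrix whose rows represent, on the basis $(1,y,\ldots,y^{n-1})$, the polynomials $$g_0,\, y g_0, \ldots, y^{n_0-1}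 g_0,\ \ldots,\ g_{\ell-1}, \ldots, y^{n_{\ell-1}-1} g_{\ell-1},$$ in this order. A matrix in $\mathbb{K}[x]^{n\times n}$ is in Hermite normal form (HNF) if it is lower triangular with monic diagonal entries and, in each column, the diagonal entry has degree larger than all other entries. The HNF of $M$ is the matrix $H = UM$ in HNF with $U$ unimodular; rows and columns are indexed from $0$. Then: 1. The HNF $H$ of $M$ and the reduced $\preccurlyeq_{\mathrm{lex}}$-Gröbner basis $\mathcal{G}_{\mathrm{lex}}$ of $I$ exist and are unique. For every $m \in \{1,\ldots,n\}$, if $B$ denotes the leading principal $m\times m$ submatrix of $H$, then $$\{p \in \mathcal{G}_{\mathrm{lex}} \mid \deg_y(p) < m\} = \Bigl\{ \sum_{0\le j<m} B_{i,j}\, y^j \Bigm| 0 \le i < m,\ i = 0 \text{ or } \deg B_{i,i} < \deg B_{i-1,i-1} \Bigr\}.$$ 2. The ideal $I$ is in shape position, meaning that $\mathcal{G}_{\mathrm{lex}} = \{f_0(x),\, y - f_1(x)\}$ for some $f_0, f_1 \in \mathbb{K}[x]$ with $\deg f_0 = D$ and $\deg f_1 < D$, if and only if $M$ has the generic row-HNF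 property: there is a unimodular $U \in \mathbb{K}[x]^{n\times n}$ such that all columns of $UM$ except the first one are those of the identity matrix. -/

import Mathlib

open scoped MonomialOrder Polynomial

noncomputable section

namespace LexFromHermite

/-! Bivariate polynomials over `K` are elements of `MvPolynomial (Fin 2) K`. Mathlib's orders on
`Fin 2 →₀ ℕ` make the variable of index `0` the largest one, so `y` has index `0` and `x` has
index `1`, which gives `x < y` for both orders below. -/

/-- The index of the variable `x`, the smaller variable. -/
abbrev vx : Fin 2 := 1

/-- The index of the variable `y`, the larger variable. -/
abbrev vy : Fin 2 := 0

/-- The lexicographic order with `x < y`. -/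
abbrev lexOrder : MonomialOrder (Fin 2) := MonomialOrder.lex

/-- The degree reverse lexicographic order with `x < y`. In two variables it is the same
order as the degree lexicographic one; see `drlOrder_lt_iff`. -/
abbrev drlOrder : MonomialOrder (Fin 2) := MonomialOrder.degLex

/-- `drlOrder` is the degree reverse lexicographic order: total degrees are compared first, and
among monomials of equal total degree the smaller one has the larger exponent in the smallest
variable `x`. -/
theorem drlOrder_lt_iff (a b : Fin 2 →₀ ℕ) :
    a ≺[drlOrder] b ↔
      a vx + a vy < b vx + b vy ∨ (a vx + a vy = b vx + b vy ∧ b vx < a vx) := by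
  rw [MonomialOrder.degLex_lt_iff, Finsupp.DegLex.lt_iff]
  simp only [ofDegLex_toDegLex, Finsupp.degree_eq_sum, Fin.sum_univ_two, Finsupp.Lex.lt_iff,
    Fin.exists_fin_two, Fin.forall_fin_two, ofLex_toLex, vx, vy]
  simp
  omega

/-- `lexOrder` compares the exponents of `y` first, then those of `x`. -/
theorem lexOrder_lt_iff (a b : Fin 2 →₀ ℕ) :
    a ≺[lexOrder] b ↔ a vy < b vy ∨ (a vy = b vy ∧ a vx < b vx) := by
  rw [MonomialOrder.lex_lt_iff]
  simp only [Finsupp.Lex.lt_iff, Fin.exists_fin_two, Fin.forall_fin_two, ofLex_toLex]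
  simp

variable {K : Type*} [Field K]

/-- `G` is a Gröbner basis of `I`: a finite subset of `I` whose leading terms generate the ideal
of leading terms of `I`. -/
structure IsGroebnerBasis (ord : MonomialOrder (Fin 2)) (I : Ideal (MvPolynomial (Fin 2) K))
    (G : Set (MvPolynomial (Fin 2) K)) : Prop where
  finite : G.Finite
  subset : G ⊆ I
  span_leadingTerm :
    Ideal.span (ord.leadingTerm '' G) =
      Ideal.span (ord.leadingTerm '' (I : Set (MvPolynomial (Fin 2) K)))

/-- A minimal Gröbner basis: its elements are nonzero, and no leading monomial divides another
one. Leading coefficients are arbitrary nonzero constants. -/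
structure IsMinimalGroebnerBasis (ord : MonomialOrder (Fin 2))
    (I : Ideal (MvPolynomial (Fin 2) K)) (G : Set (MvPolynomial (Fin 2) K)) : Prop
    extends IsGroebnerBasis ord I G where
  zero_notMem : (0 : MvPolynomial (Fin 2) K) ∉ G
  not_dvd : ∀ p ∈ G, ∀ q ∈ G, p ≠ q → ¬ ord.degree q ≤ ord.degree p

/-- The reduced Gröbner basis: all elements are monic, and no monomial of an element is
divisible by the leading monomial of another element. -/
structure IsReducedGroebnerBasis (ord : MonomialOrder (Fin 2))
    (I : Ideal (MvPolynomial (Fin 2) K)) (G : Set (MvPolynomial (Fin 2) K)) : Prop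
    extends IsGroebnerBasis ord I G where
  monic : ∀ p ∈ G, ord.Monic p
  not_dvd : ∀ p ∈ G, ∀ q ∈ G, p ≠ q → ∀ s ∈ p.support, ¬ ord.degree q ≤ s

/-- The degree in `y`. -/
def yDeg (f : MvPolynomial (Fin 2) K) : ℕ := f.degreeOf vy

/-- The degree in `y` of the leading monomial for the degree reverse lexicographic order. -/
def lmYDeg (f : MvPolynomial (Fin 2) K) : ℕ := drlOrder.degree f vy

/-- A bivariate polynomial viewed as a polynomial in `y` with coefficients in `K[x]`. -/
def viewInY : MvPolynomial (Fin 2) K →ₐ[K] K[X][X] :=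
  MvPolynomial.aeval ![Polynomial.X, Polynomial.C Polynomial.X]

/-- A univariate polynomial in `K[x]` viewed as a bivariate polynomial. -/
def ofX : K[X] →ₐ[K] MvPolynomial (Fin 2) K := Polynomial.aeval (MvPolynomial.X vx)

/-- The polynomial `∑ j, v j * y ^ j` represented by a row vector `v` over `K[x]`. -/
def rowPoly {m : ℕ} (v : Fin m → K[X]) : MvPolynomial (Fin 2) K :=
  ∑ j : Fin m, ofX (v j) * MvPolynomial.X vy ^ (j : ℕ)

section Construction

variable {l : ℕ} (g : Fin l → MvPolynomial (Fin 2) K)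

/-- `ydeg (lm g_{i+1}) - ydeg (lm g_i)`, for an index `i` that is not the last one. -/
def gap (i : Fin l) (h : (i : ℕ) + 1 < l) : ℕ := lmYDeg (g ⟨i + 1, h⟩) - lmYDeg (g i)

/-- The sizes `n_i` of the blocks. For the last index, the value is
`max (1, max_j (n_j + ydeg g_j) - ydeg g_{l-1})`, where `j` ranges over the other indices. -/
def blockSize (i : Fin l) : ℕ :=
  if h : (i : ℕ) + 1 < l then gap g i h
  else max 1 ((Finset.univ.sup fun j : Fin l =>
    if hj : (j : ℕ) + 1 < l then gap g j hj + yDeg (g j) else 0) - yDeg (g i))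

/-- The dimension `n = n_0 + ⋯ + n_{l-1}`. -/
def dim : ℕ := ∑ i, blockSize g i

/-- The tuple `(g_0, y g_0, …, y^(n_0 - 1) g_0, …, g_{l-1}, …, y^(n_{l-1} - 1) g_{l-1})`. -/
def extendedBasis (r : Fin (dim g)) : MvPolynomial (Fin 2) K :=
  let p : (i : Fin l) × Fin (blockSize g i) := finSigmaFinEquiv.symm r
  MvPolynomial.X vy ^ (p.2 : ℕ) * g p.1

/-- The block-Toeplitz matrix whose `r`-th row represents the `r`-th polynomial of the extended
tuple on the basis `1, y, …, y^(n-1)`. -/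
def toeplitzMatrix : Matrix (Fin (dim g)) (Fin (dim g)) K[X] :=
  Matrix.of fun r j => (viewInY (extendedBasis g r)).coeff (j : ℕ)

end Construction

/-- (Row) Hermite normal form: lower triangular, with monic diagonal entries whose degree is
larger than that of all other entries in the same column. -/
structure IsHermite {n : ℕ} (H : Matrix (Fin n) (Fin n) K[X]) : Prop where
  lower : ∀ i j, i < j → H i j = 0
  monic : ∀ j, (H j j).Monic
  degree_lt : ∀ i j, i ≠ j → (H i j).degree < (H j j).degree

/-- `H` is the Hermite normal form of `M`: it is in Hermite normal form, and `H = U * M` with `U`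
unimodular. -/
def IsHermiteFormOf {n : ℕ} (H M : Matrix (Fin n) (Fin n) K[X]) : Prop :=
  IsHermite H ∧ ∃ U : Matrix (Fin n) (Fin n) K[X], IsUnit U.det ∧ H = U * M

/-- The generic row Hermite form property: for some unimodular `U`, the columns of `U * M` other
than the first one are those of the identity matrix. -/
def GenericRowHermite {n : ℕ} (M : Matrix (Fin n) (Fin n) K[X]) : Prop :=
  ∃ U : Matrix (Fin n) (Fin n) K[X], IsUnit U.det ∧
    ∀ i j : Fin n, (j : ℕ) ≠ 0 → (U * M) i j = (1 : Matrix (Fin n) (Fin n) K[X]) i j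

/-- The polynomials read off from the rows of `B`: those represented by the first row and by each
row whose diagonal entry has a smaller degree than the previous diagonal entry. -/
def readOff {m : ℕ} (B : Matrix (Fin m) (Fin m) K[X]) : Set (MvPolynomial (Fin 2) K) :=
  {p | ∃ i : Fin m,
    (∀ k : Fin m, (k : ℕ) + 1 = i → (B i i).degree < (B k k).degree) ∧ p = rowPoly (B i)}

/-- Shape position: with `D` the degree of `I`, the reduced lexicographic Gröbner basis is
`(f₀(x), y - f₁(x))` with `deg f₀ = D` and `deg f₁ < D`. -/
def IsShapePosition (I : Ideal (MvPolynomial (Fin 2) K)) : Prop :=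
  ∃ f₀ f₁ : K[X],
    f₀.degree = (Module.finrank K (MvPolynomial (Fin 2) K ⧸ I) : ℕ) ∧
    f₁.degree < (Module.finrank K (MvPolynomial (Fin 2) K ⧸ I) : ℕ) ∧
    IsReducedGroebnerBasis lexOrder I {ofX f₀, MvPolynomial.X vy - ofX f₁}

end LexFromHermite

end

open LexFromHermite

/-!
# Lexicographic Gröbner bases from Hermite normal forms

The rows of the block-Toeplitz matrix of a minimal degree reverse lexicographic Gröbner basis
generate the `K[x]`-module of the elements of `I` of bounded degree in `y`. The Hermite normal form
of this module exists and is unique, and the rows at which the degree of the diagonal drops form the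
reduced lexicographic Gröbner basis of `I`.
-/

/-! Let `N` be the `K[x]`-module of elements of `I` of `y`-degree less than `n = dim g`, seen as row
vectors (`rowModule`). The argument passes through `N` and its Hermite basis `H`.

The rows of the block-Toeplitz matrix generate `N` (`mem_rowModule_iff_toeplitzMatrix`). The block
sizes are such that every `y`-degree `b < n` is that of the leading monomial of some `y^j g_i`, with
`g_i` of least possible `x`-exponent. Hence division of an element of `N` by these polynomials only
uses multipliers in `K[x]`, and it stays inside `N`. So the Hermite form of the matrix depends on
`N` alone; it exists because `K[x]` is principal and `N` has full rank, and it is unique by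
comparison of degrees.

Row `i` of `H` has lexicographic leading monomial `x^(deg H i i) y^i`. Multiplication by `y` shows
that each diagonal entry divides the previous ones, so the rows where the degree drops carry the
minimal leading monomials, and the Hermite degree bounds are exactly the reducedness of the basis
(`isReducedGroebnerBasis_readOff`). Degrees `y^b` with `b ≥ n` bring nothing new, since `I` has an
element monic in `y`, up to a constant, of `y`-degree less than `n`.

Finally, shape position and the generic row-HNF property are both equivalent to `H 1 1 = 1`. -/

namespace LexFromHermite

variable {K : Type*} [Field K]

/-! ### Existence and uniqueness of Hermite normal forms over `K[x]`. -/

section Hermite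

open Matrix Polynomial

variable {n : ℕ} {H H' M : Matrix (Fin n) (Fin n) K[X]}

theorem IsHermite.det_ne_zero (hH : IsHermite H) : H.det ≠ 0 := by
  rw [Matrix.det_of_isLowerTriangular H fun i j h => hH.lower i j h]
  exact Finset.prod_ne_zero_iff.2 fun i _ => (hH.monic i).ne_zero

theorem IsHermite.vecMul_apply (hH : IsHermite H) {c : Fin n → K[X]} {j : Fin n}
    (h : ∀ k, j < k → c k = 0) : (c ᵥ* H) j = c j * H j j := by
  simp only [Matrix.vecMul, dotProduct]
  refine Finset.sum_eq_single j (fun i _ hi => ?_) (by simp)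
  rcases lt_or_gt_of_ne hi with hi | hi
  · rw [hH.lower i j hi, mul_zero]
  · rw [h i hi, zero_mul]

theorem IsHermite.eq_zero_of_vecMul (hH : IsHermite H) {c : Fin n → K[X]} {j : Fin n}
    (h : ∀ k, j < k → (c ᵥ* H) k = 0) (k : Fin n) : j < k → c k = 0 := by
  induction k using WellFoundedGT.induction with
  | ind k ih =>
    intro hk
    have := h k hk
    rw [hH.vecMul_apply fun i hi => ih i hi (hk.trans hi)] at this
    exact (mul_eq_zero.1 this).resolve_right (hH.monic k).ne_zero

/-- A diagonal entry of a Hermite form divides the corresponding entry of every combination of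
the rows that vanishes to the right of it. -/
theorem IsHermite.dvd_vecMul (hH : IsHermite H) {c : Fin n → K[X]} {j : Fin n}
    (h : ∀ k, j < k → (c ᵥ* H) k = 0) : H j j ∣ (c ᵥ* H) j := by
  rw [hH.vecMul_apply (hH.eq_zero_of_vecMul h)]
  exact dvd_mul_left _ _

/-- By triangularity, the last nonzero coefficient `c k` would produce the entry `c k * H k k`,
whose degree is too large. The induction runs from the last index down. -/
theorem IsHermite.eq_zero_of_degree_lt (hH : IsHermite H) {c : Fin n → K[X]}
    (h : ∀ k, ((c ᵥ* H) k).degree < (H k k).degree) (k : Fin n) : c k = 0 := by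
  induction k using WellFoundedGT.induction with
  | ind k ih =>
    have := h k
    rw [hH.vecMul_apply ih] at this
    by_contra hc
    rw [degree_mul, degree_eq_natDegree hc, degree_eq_natDegree (hH.monic k).ne_zero] at this
    norm_cast at this
    omega

theorem IsHermite.eq_of_mul (hH : IsHermite H) (hH' : IsHermite H')
    {A B : Matrix (Fin n) (Fin n) K[X]} (hA : H = A * H') (hB : H' = B * H) : H = H' := by
  have diag (j : Fin n) : H j j = H' j j := by
    refine eq_of_monic_of_associated (hH.monic j) (hH'.monic j) (associated_of_dvd_dvd ?_ ?_)
    · have e : H' j = B j ᵥ* H := congrFun hB j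
      rw [e]
      exact hH.dvd_vecMul fun k hk => by rw [← e, hH'.lower j k hk]
    · have e : H j = A j ᵥ* H' := congrFun hA j
      rw [e]
      exact hH'.dvd_vecMul fun k hk => by rw [← e, hH.lower j k hk]
  -- With equal diagonals, each row of `H - H'` is a combination of rows of `H` whose entries are
  -- all smaller than the diagonal, hence it is zero.
  have e : H - H' = (1 - B) * H := by rw [sub_mul, one_mul, ← hB]
  have hz : 1 - B = 0 := by
    ext1 i k
    refine hH.eq_zero_of_degree_lt (c := (1 - B) i) (fun j => ?_) k
    have e' : H i - H' i = (1 - B) i ᵥ* H := congrFun e i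
    rw [← e', Pi.sub_apply]
    by_cases hij : i = j
    · subst hij
      rw [diag, sub_self, degree_zero]
      exact bot_lt_iff_ne_bot.2 (degree_eq_bot.not.2 (hH'.monic i).ne_zero)
    · refine (degree_sub_le _ _).trans_lt (max_lt (hH.degree_lt i j hij) ?_)
      rw [diag]
      exact hH'.degree_lt i j hij
  rw [hz, zero_mul, sub_eq_zero] at e
  exact e

/-- Being the Hermite form of `M` only depends on the row module of `M`. If the rows generate each
other through `U` and `V`, then `U * V * H = H`, and `det H ≠ 0` forces `det U * det V = 1`. -/
theorem isHermiteFormOf_iff :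
    IsHermiteFormOf H M ↔ IsHermite H ∧ ∀ v, (∃ c, c ᵥ* M = v) ↔ ∃ c, c ᵥ* H = v := by
  refine and_congr_right fun hH => ⟨?_, fun h => ?_⟩
  · rintro ⟨U, hU, rfl⟩ v
    constructor
    · rintro ⟨c, rfl⟩
      exact ⟨c ᵥ* U⁻¹, by rw [vecMul_vecMul, ← mul_assoc, nonsing_inv_mul _ hU, one_mul]⟩
    · rintro ⟨c, rfl⟩
      exact ⟨c ᵥ* U, by rw [vecMul_vecMul]⟩
  · choose U hU using fun i => (h (H i)).2 ⟨Pi.single i 1, by simp [Matrix.row]⟩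
    choose V hV using fun i => (h (M i)).1 ⟨Pi.single i 1, by simp [Matrix.row]⟩
    have hU' : Matrix.of U * M = H := funext hU
    have hV' : Matrix.of V * H = M := funext hV
    refine ⟨Matrix.of U, ?_, hU'.symm⟩
    have : (Matrix.of U * Matrix.of V).det * H.det = 1 * H.det := by
      rw [← det_mul, mul_assoc, hV', hU', one_mul]
    have := mul_right_cancel₀ hH.det_ne_zero this
    rw [det_mul] at this
    exact IsUnit.of_mul_eq_one _ this

theorem IsHermiteFormOf.unique (h : IsHermiteFormOf H M) (h' : IsHermiteFormOf H' M) :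
    H = H' := by
  obtain ⟨hH, U, hU, rfl⟩ := h
  obtain ⟨hH', V, hV, rfl⟩ := h'
  refine hH.eq_of_mul hH' (A := U * V⁻¹) (B := V * U⁻¹) ?_ ?_
  · rw [mul_assoc, ← mul_assoc V⁻¹, nonsing_inv_mul _ hV, one_mul]
  · rw [mul_assoc, ← mul_assoc U⁻¹, nonsing_inv_mul _ hU, one_mul]

/-- The `j`-th entries of the vectors of `N` that vanish beyond `j` form an ideal of `K[x]`. A
vector reaching its generator, scaled to be monic, serves as the `j`-th pivot. -/
theorem exists_monic_dvd (N : Submodule K[X] (Fin n → K[X])) (j : Fin n)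
    (hN : ∃ v ∈ N, (∀ k, j < k → v k = 0) ∧ v j ≠ 0) :
    ∃ p ∈ N, (∀ k, j < k → p k = 0) ∧ (p j).Monic ∧
      ∀ v ∈ N, (∀ k, j < k → v k = 0) → p j ∣ v j := by
  let J : Ideal K[X] :=
    { carrier := {a | ∃ v ∈ N, (∀ k, j < k → v k = 0) ∧ v j = a}
      add_mem' := by
        rintro _ _ ⟨v, hv, h, rfl⟩ ⟨w, hw, h', rfl⟩
        exact ⟨v + w, N.add_mem hv hw, fun k hk => by simp [h k hk, h' k hk], rfl⟩
      zero_mem' := ⟨0, N.zero_mem, fun _ _ => rfl, rfl⟩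
      smul_mem' := by
        rintro c _ ⟨v, hv, h, rfl⟩
        exact ⟨c • v, N.smul_mem c hv, fun k hk => by simp [h k hk], rfl⟩ }
  have hJ (a : K[X]) : a ∈ J ↔ ∃ v ∈ N, (∀ k, j < k → v k = 0) ∧ v j = a := Iff.rfl
  obtain ⟨d, hd⟩ := IsPrincipalIdealRing.principal J
  have hdJ (a : K[X]) : a ∈ J ↔ d ∣ a := by rw [hd]; exact Ideal.mem_span_singleton
  obtain ⟨p, hp, hp0, rfl⟩ := (hJ d).1 ((hdJ d).2 dvd_rfl)
  have hne : p j ≠ 0 := by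
    obtain ⟨v, hv, h, hvj⟩ := hN
    intro h0
    have := (hdJ (v j)).1 ⟨v, hv, h, rfl⟩
    rw [h0, zero_dvd_iff] at this
    exact hvj this
  refine ⟨C (p j).leadingCoeff⁻¹ • p, N.smul_mem _ hp, fun k hk => by simp [hp0 k hk], ?_, ?_⟩
  · simpa [mul_comm] using monic_mul_leadingCoeff_inv hne
  · intro v hv h
    have : p j ∣ v j := (hdJ _).1 ⟨v, hv, h, rfl⟩
    have hu : IsUnit (C (p j).leadingCoeff⁻¹ : K[X]) :=
      isUnit_C.2 (isUnit_iff_ne_zero.2 (inv_ne_zero (leadingCoeff_ne_zero.2 hne)))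
    simpa using (hu.mul_left_dvd).2 this

theorem exists_reduction {N : Submodule K[X] (Fin n → K[X])} {P : Fin n → Fin n → K[X]}
    (hP : ∀ j, P j ∈ N) (h0 : ∀ j k, j < k → P j k = 0) (hm : ∀ j, (P j j).Monic) (m : ℕ)
    (v : Fin n → K[X]) :
    ∃ w ∈ N, (∀ k : Fin n, m ≤ k → w k = 0) ∧
      ∀ k : Fin n, (k : ℕ) < m → (v k - w k).degree < (P k k).degree := by
  induction m generalizing v with
  | zero => exact ⟨0, N.zero_mem, by simp, by simp⟩
  | succ m ih =>
    by_cases hmn : m < n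
    · let j : Fin n := ⟨m, hmn⟩
      -- Columns are reduced from right to left: subtracting a multiple of `P j` alters only columns
      -- up to `j`, and the later corrections `w` vanish from column `j` on.
      obtain ⟨w, hw, hw0, hw1⟩ := ih (v - (v j /ₘ P j j) • P j)
      refine ⟨(v j /ₘ P j j) • P j + w, N.add_mem (N.smul_mem _ (hP j)) hw, fun k hk => ?_,
        fun k hk => ?_⟩
      · simp [hw0 k (by omega), h0 j k (Fin.lt_def.2 (by simp [j]; omega))]
      · rcases Nat.lt_succ_iff_lt_or_eq.1 hk with hk | hk
        · simpa [sub_sub] using hw1 k hk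
        · obtain rfl : k = j := Fin.ext hk
          have : v j - (v j /ₘ P j j * P j j) = v j %ₘ P j j := by
            rw [modByMonic_eq_sub_mul_div, mul_comm]
          simp only [Pi.add_apply, Pi.smul_apply, smul_eq_mul, hw0 j hk.ge, add_zero, this]
          exact degree_modByMonic_lt _ (hm j)
    · obtain ⟨w, hw, -, hw1⟩ := ih v
      exact ⟨w, hw, fun k hk => by omega, fun k _ => hw1 k (by omega)⟩

theorem exists_isHermite (N : Submodule K[X] (Fin n → K[X]))
    (hN : ∀ j, ∃ v ∈ N, (∀ k, j < k → v k = 0) ∧ v j ≠ 0) :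
    ∃ H, IsHermite H ∧ ∀ v, v ∈ N ↔ ∃ c, c ᵥ* H = v := by
  choose P hP h0 hm hdvd using fun j => exists_monic_dvd N j (hN j)
  -- Only the columns strictly left of the diagonal are reduced, so the pivots are unchanged.
  choose w hw hw0 hw1 using fun j : Fin n => exists_reduction hP h0 hm j (P j)
  let H : Matrix (Fin n) (Fin n) K[X] := Matrix.of fun j => P j - w j
  have hHN (j : Fin n) : H j ∈ N := N.sub_mem (hP j) (hw j)
  have hdiag (j : Fin n) : H j j = P j j := by simp [H, hw0 j j le_rfl]
  have hlow (i j : Fin n) (hij : i < j) : H i j = 0 := by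
    simp [H, h0 i j hij, hw0 i j hij.le]
  refine ⟨H, ⟨hlow, fun j => hdiag j ▸ hm j, fun i j hij => ?_⟩, fun v => ⟨fun hv => ?_, ?_⟩⟩
  · rw [hdiag]
    rcases lt_or_gt_of_ne hij with h | h
    · rw [hlow i j h, degree_zero]
      exact bot_lt_iff_ne_bot.2 (degree_eq_bot.not.2 (hm j).ne_zero)
    · exact hw1 i j h
  · suffices ∀ m : ℕ, ∀ v ∈ N, (∀ k : Fin n, m ≤ k → v k = 0) → ∃ c, c ᵥ* H = v from
      this n v hv fun k hk => by omega
    intro m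
    induction m with
    | zero => exact fun v _ h => ⟨0, by funext k; simp [h k]⟩
    | succ m ih =>
      intro v hv hk
      by_cases hmn : m < n
      · let j : Fin n := ⟨m, hmn⟩
        have hj (k : Fin n) (h : j < k) : v k = 0 := hk k (Fin.lt_def.1 h)
        obtain ⟨q, hq⟩ := hdvd j v hv hj
        obtain ⟨c, hc⟩ := ih (v - q • H j) (N.sub_mem hv (N.smul_mem _ (hHN j))) fun k hkm => by
          rcases hkm.lt_or_eq with h | h
          · simp [hj k h, hlow j k h]
          · obtain rfl : j = k := Fin.ext h
            simp [hdiag, hq, mul_comm]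
        exact ⟨c + Pi.single j q, by rw [add_vecMul, hc, single_vecMul]; simp [Matrix.row]⟩
      · exact ih v hv fun k h => by omega
  · rintro ⟨c, rfl⟩
    rw [vecMul_eq_sum]
    exact N.sum_mem fun i _ => N.smul_mem _ (hHN i)

end Hermite

/-! ### Divisibility criterion for Gröbner bases and uniqueness of the reduced one. -/

section GroebnerBasis

open MvPolynomial

variable {ord : MonomialOrder (Fin 2)} {I : Ideal (MvPolynomial (Fin 2) K)}
  {G G' : Set (MvPolynomial (Fin 2) K)}

theorem IsGroebnerBasis.exists_degree_le (hG : IsGroebnerBasis ord I G)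
    {f : MvPolynomial (Fin 2) K} (hf : f ∈ I) (hf0 : f ≠ 0) :
    ∃ g ∈ G, g ≠ 0 ∧ ord.degree g ≤ ord.degree f := by
  have h1 : ord.leadingTerm f ∈ Ideal.span (ord.leadingTerm '' G) := by
    rw [hG.span_leadingTerm]
    exact Ideal.subset_span ⟨f, hf, rfl⟩
  have h2 : Ideal.span (ord.leadingTerm '' G) ≤
      -- Zero must be removed: its degree is `0` by convention, which would divide every monomial.
      Ideal.span ((fun s => monomial s (1 : K)) '' (ord.degree '' (G \ {0}))) := by
    rw [Ideal.span_le]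
    rintro _ ⟨g, hg, rfl⟩
    by_cases hg0 : g = 0
    · simp [hg0]
    · have : ord.leadingTerm g = C (ord.leadingCoeff g) * monomial (ord.degree g) 1 := by
        rw [C_mul_monomial, mul_one]; rfl
      rw [this]
      exact Ideal.mul_mem_left _ _ (Ideal.subset_span ⟨_, ⟨g, ⟨hg, hg0⟩, rfl⟩, rfl⟩)
  have h3 := mem_ideal_span_monomial_image.1 (h2 h1) (ord.degree f) (by
    rw [MonomialOrder.support_leadingTerm' hf0]; simp)
  obtain ⟨_, ⟨g, ⟨hg, hg0⟩, rfl⟩, h⟩ := h3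
  exact ⟨g, hg, hg0, h⟩

theorem isGroebnerBasis_of_exists_degree_le (hfin : G.Finite) (hsub : G ⊆ I)
    (hm : ∀ p ∈ G, ord.Monic p)
    (h : ∀ f ∈ I, f ≠ 0 → ∃ p ∈ G, ord.degree p ≤ ord.degree f) : IsGroebnerBasis ord I G := by
  refine ⟨hfin, hsub, le_antisymm (Ideal.span_mono (Set.image_mono hsub)) ?_⟩
  rw [Ideal.span_le]
  rintro _ ⟨f, hf, rfl⟩
  by_cases hf0 : f = 0
  · simp [hf0]
  · obtain ⟨p, hp, hpf⟩ := h f hf hf0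
    have : ord.leadingTerm f =
        monomial (ord.degree f - ord.degree p) (ord.leadingCoeff f) * ord.leadingTerm p := by
      rw [MonomialOrder.leadingTerm, MonomialOrder.leadingTerm, (hm p hp).leadingCoeff_eq_one,
        monomial_mul, mul_one, tsub_add_cancel_of_le hpf]
    rw [this]
    exact Ideal.mul_mem_left _ _ (Ideal.subset_span ⟨p, hp, rfl⟩)

/-- Minimality matches `p ∈ G` with some `q ∈ G'` of the same leading monomial. If `p ≠ q`, the
leading monomial of `p - q ∈ I` is smaller, occurs in `p` or `q`, and is divisible by leading
monomials from both bases, against reducedness. -/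
theorem IsReducedGroebnerBasis.subset_of (hG : IsReducedGroebnerBasis ord I G)
    (hG' : IsReducedGroebnerBasis ord I G') : G ⊆ G' := by
  intro p hp
  have hp0 : p ≠ 0 := (hG.monic p hp).ne_zero
  obtain ⟨q, hq, hq0, hqp⟩ := hG'.exists_degree_le (hG.subset hp) hp0
  obtain ⟨p', hp', hp'0, hpq⟩ := hG.exists_degree_le (hG'.subset hq) hq0
  have hpp' : p = p' := by
    by_contra hne
    exact hG.not_dvd p hp p' hp' hne _ (ord.degree_mem_support hp0) (hpq.trans hqp)
  subst hpp'
  have hdeg : ord.degree p = ord.degree q := le_antisymm hpq hqp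
  suffices p = q from this ▸ hq
  by_contra hne
  have hsub : p - q ≠ 0 := sub_ne_zero.2 hne
  set s := ord.degree (p - q)
  have hmem : s ∈ (p - q).support := ord.degree_mem_support hsub
  have hcs : (p - q).coeff s ≠ 0 := mem_support_iff.1 hmem
  have hsne : s ≠ ord.degree p := by
    rintro h
    rw [h, coeff_sub, (hG.monic p hp).coeff_degree, hdeg, (hG'.monic q hq).coeff_degree,
      sub_self] at hcs
    exact hcs rfl
  have hslt : s ≺[ord] ord.degree p := by
    refine lt_of_le_of_ne ?_ (fun h => hsne (ord.toSyn.injective h))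
    have := ord.degree_sub_le (f := p) (g := q)
    rwa [← hdeg, sup_idem] at this
  have key (G₀ : Set (MvPolynomial (Fin 2) K)) (hG₀ : IsReducedGroebnerBasis ord I G₀)
      (r : MvPolynomial (Fin 2) K) (hr : r ∈ G₀) (hrp : ord.degree r = ord.degree p) :
      s ∉ r.support := by
    intro hsr
    obtain ⟨t, ht, ht0, hts⟩ := hG₀.exists_degree_le
      (I.sub_mem (hG.subset hp) (hG'.subset hq)) hsub
    by_cases hrt : r = t
    · subst hrt
      rw [hrp] at hts
      exact absurd (ord.toSyn_monotone hts) (not_le.2 hslt)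
    · exact hG₀.not_dvd r hr t ht hrt s hsr hts
  have h1 := key G hG p hp rfl
  have h2 := key G' hG' q hq hdeg.symm
  rw [notMem_support_iff] at h1 h2
  exact hcs (by rw [coeff_sub, h1, h2, sub_self])

theorem IsReducedGroebnerBasis.unique (hG : IsReducedGroebnerBasis ord I G)
    (hG' : IsReducedGroebnerBasis ord I G') : G = G' :=
  (hG.subset_of hG').antisymm (hG'.subset_of hG)

end GroebnerBasis

/-! ### Translation between bivariate polynomials, `K[x][y]` and row vectors. -/

section View

open Polynomial

/-- The exponent vector of `x ^ a * y ^ b`. -/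
noncomputable def expo (a b : ℕ) : Fin 2 →₀ ℕ := Finsupp.single vx a + Finsupp.single vy b

@[simp] theorem expo_vx (a b : ℕ) : expo a b vx = a := by simp [expo, vx, vy]

@[simp] theorem expo_vy (a b : ℕ) : expo a b vy = b := by simp [expo, vx, vy]

theorem expo_eta (s : Fin 2 →₀ ℕ) : expo (s vx) (s vy) = s := by
  ext i
  fin_cases i
  · exact expo_vy _ _
  · exact expo_vx _ _

theorem exponent_le_iff {s t : Fin 2 →₀ ℕ} : s ≤ t ↔ s vx ≤ t vx ∧ s vy ≤ t vy := by
  rw [Finsupp.le_def, Fin.forall_fin_two]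
  exact and_comm

theorem coeff_viewInY (f : MvPolynomial (Fin 2) K) (a b : ℕ) :
    ((viewInY f).coeff b).coeff a = f.coeff (expo a b) := by
  induction f using MvPolynomial.induction_on' with
  | monomial s c =>
    have : viewInY (MvPolynomial.monomial s c) = C (C c * X ^ s vx) * X ^ s vy := by
      rw [viewInY, MvPolynomial.aeval_monomial, Finsupp.prod_fintype _ _ (by simp),
        Fin.prod_univ_two]
      simp only [Matrix.cons_val_zero, Matrix.cons_val_one, map_mul, map_pow]
      rw [show algebraMap K K[X][X] c = C (C c) from rfl]
      ring
    rw [this, coeff_C_mul_X_pow, MvPolynomial.coeff_monomial]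
    by_cases hb : b = s vy
    · rw [if_pos hb, coeff_C_mul_X_pow]
      refine if_congr ⟨fun h => ?_, fun h => ?_⟩ rfl rfl
      · rw [h, hb, expo_eta]
      · rw [h, expo_vx]
    · rw [if_neg hb, if_neg, coeff_zero]
      rintro rfl
      exact hb (expo_vy _ _).symm
  | add p q hp hq => simp [hp, hq]

theorem viewInY_injective : Function.Injective (viewInY (K := K)) := by
  intro f g h
  ext s
  rw [← expo_eta s, ← coeff_viewInY, h, coeff_viewInY]

theorem viewInY_ofX (p : K[X]) : viewInY (ofX p) = C p := by
  have : (viewInY (K := K)).comp ofX = (CAlgHom (R := K[X]) (A := K[X])).restrictScalars K := by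
    apply Polynomial.algHom_ext
    simp [viewInY, ofX]
  exact DFunLike.congr_fun this p

theorem viewInY_X_vy : viewInY (MvPolynomial.X vy : MvPolynomial (Fin 2) K) = X := by
  simp [viewInY]

theorem viewInY_rowPoly {m : ℕ} (v : Fin m → K[X]) :
    viewInY (rowPoly v) = ∑ j : Fin m, C (v j) * X ^ (j : ℕ) := by
  simp [rowPoly, viewInY_ofX, viewInY_X_vy]

theorem coeff_viewInY_rowPoly {m : ℕ} (v : Fin m → K[X]) (j : ℕ) :
    (viewInY (rowPoly v)).coeff j = if h : j < m then v ⟨j, h⟩ else 0 := by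
  rw [viewInY_rowPoly, finsetSum_coeff]
  simp only [coeff_C_mul_X_pow]
  split_ifs with h
  · rw [Finset.sum_eq_single ⟨j, h⟩] <;> simp
    exact fun i hi hj => absurd (Fin.ext hj.symm) hi
  · exact Finset.sum_eq_zero fun i _ => if_neg (by omega)

theorem coeff_rowPoly {m : ℕ} (v : Fin m → K[X]) (s : Fin 2 →₀ ℕ) :
    (rowPoly v).coeff s = if h : s vy < m then (v ⟨s vy, h⟩).coeff (s vx) else 0 := by
  rw [← expo_eta s, ← coeff_viewInY, coeff_viewInY_rowPoly]
  simp only [expo_vx, expo_vy]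
  split_ifs <;> simp

theorem yDeg_eq_natDegree (f : MvPolynomial (Fin 2) K) : yDeg f = (viewInY f).natDegree := by
  refine eq_of_forall_ge_iff fun d => ?_
  rw [yDeg, MvPolynomial.degreeOf_le_iff, natDegree_le_iff_coeff_eq_zero]
  constructor
  · intro h j hj
    ext a
    rw [coeff_viewInY, coeff_zero, ← MvPolynomial.notMem_support_iff]
    intro hs
    have := h _ hs
    rw [expo_vy] at this
    omega
  · intro h s hs
    by_contra! hd
    rw [MvPolynomial.mem_support_iff, ← expo_eta s, ← coeff_viewInY, h _ hd] at hs
    exact hs (coeff_zero _)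

theorem le_yDeg {f : MvPolynomial (Fin 2) K} {s : Fin 2 →₀ ℕ} (hs : s ∈ f.support) :
    s vy ≤ yDeg f :=
  MvPolynomial.degreeOf_le_iff.1 le_rfl s hs

theorem rowPoly_coeff_viewInY {m : ℕ} {f : MvPolynomial (Fin 2) K} (hf : yDeg f < m) :
    rowPoly (fun j : Fin m => (viewInY f).coeff j) = f := by
  apply viewInY_injective
  ext1 j
  rw [coeff_viewInY_rowPoly]
  split_ifs with h
  · rfl
  · rw [yDeg_eq_natDegree] at hf
    exact (coeff_eq_zero_of_natDegree_lt (by omega)).symm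

theorem yDeg_rowPoly_lt {m : ℕ} (v : Fin m → K[X]) (hm : 0 < m) : yDeg (rowPoly v) < m := by
  have : yDeg (rowPoly v) ≤ m - 1 := by
    rw [yDeg_eq_natDegree, natDegree_le_iff_coeff_eq_zero]
    intro j hj
    rw [coeff_viewInY_rowPoly, dif_neg (by omega)]
  omega

theorem rowPoly_injective {m : ℕ} : Function.Injective (rowPoly (K := K) (m := m)) := by
  intro v w h
  funext j
  have := coeff_viewInY_rowPoly v j
  rw [h, coeff_viewInY_rowPoly] at this
  simpa using this.symm

theorem rowPoly_add {m : ℕ} (v w : Fin m → K[X]) : rowPoly (v + w) = rowPoly v + rowPoly w := by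
  simp [rowPoly, add_mul, Finset.sum_add_distrib]

theorem rowPoly_smul {m : ℕ} (p : K[X]) (v : Fin m → K[X]) :
    rowPoly (p • v) = ofX p * rowPoly v := by
  simp [rowPoly, Finset.mul_sum, mul_assoc]

theorem rowPoly_vecMul {m n : ℕ} (c : Fin n → K[X]) (M : Matrix (Fin n) (Fin m) K[X]) :
    rowPoly (Matrix.vecMul c M) = ∑ i, ofX (c i) * rowPoly (M i) := by
  simp only [rowPoly, Matrix.vecMul, dotProduct, map_sum, map_mul, Finset.sum_mul, Finset.mul_sum]
  rw [Finset.sum_comm]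
  simp only [mul_assoc]

/-- The vectors over `K[x]` that represent elements of `I`. -/
def rowModule (I : Ideal (MvPolynomial (Fin 2) K)) (m : ℕ) : Submodule K[X] (Fin m → K[X]) where
  carrier := {v | rowPoly v ∈ I}
  add_mem' hv hw := by
    simp only [Set.mem_ofPred_eq, rowPoly_add] at *
    exact I.add_mem hv hw
  zero_mem' := by simp [rowPoly]
  smul_mem' c v hv := by
    simp only [Set.mem_ofPred_eq, rowPoly_smul] at *
    exact I.mul_mem_left _ hv

theorem mem_rowModule {I : Ideal (MvPolynomial (Fin 2) K)} {m : ℕ} {v : Fin m → K[X]} :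
    v ∈ rowModule I m ↔ rowPoly v ∈ I := Iff.rfl

end View

/-! ### The rows of the block-Toeplitz matrix generate the module of bounded `y`-degree. -/

section RowSpan

open MvPolynomial

variable {I : Ideal (MvPolynomial (Fin 2) K)}

/-- Each variable is integral over `K` modulo `I`, the quotient being finite-dimensional. -/
theorem exists_aeval_X_mem [Module.Finite K (MvPolynomial (Fin 2) K ⧸ I)] (i : Fin 2) :
    ∃ p : K[X], p ≠ 0 ∧ Polynomial.aeval (X i : MvPolynomial (Fin 2) K) p ∈ I := by
  obtain ⟨p, hp, h⟩ := IsIntegral.of_finite K (Ideal.Quotient.mkₐ K I (X i))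
  refine ⟨p, hp.ne_zero, ?_⟩
  rw [← Polynomial.aeval_def, Polynomial.aeval_algHom_apply] at h
  exact Ideal.Quotient.eq_zero_iff_mem.1 h

theorem degree_ne_zero (ord : MonomialOrder (Fin 2)) (hI : I ≠ ⊤) {f : MvPolynomial (Fin 2) K}
    (hf : f ∈ I) (hf0 : f ≠ 0) : ord.degree f ≠ 0 := by
  intro h
  rw [MonomialOrder.eq_C_of_degree_eq_zero h] at hf
  exact hI (Ideal.eq_top_of_isUnit_mem _ hf
    ((isUnit_iff_ne_zero.2 (MonomialOrder.leadingCoeff_ne_zero_iff.2 hf0)).map C))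

theorem ofX_injective : Function.Injective (ofX (K := K)) := fun p q h =>
  Polynomial.C_injective (by rw [← viewInY_ofX, h, viewInY_ofX])

theorem ofX_monomial (a : ℕ) (c : K) : ofX (Polynomial.monomial a c) = monomial (expo a 0) c := by
  rw [ofX, Polynomial.aeval_monomial, expo, Finsupp.single_zero, add_zero, ← C_mul_X_pow_eq_monomial]
  rfl

theorem yDeg_mul_le (f g : MvPolynomial (Fin 2) K) : yDeg (f * g) ≤ yDeg f + yDeg g := by
  simp only [yDeg_eq_natDegree, map_mul]
  exact Polynomial.natDegree_mul_le

theorem yDeg_sub_le (f g : MvPolynomial (Fin 2) K) : yDeg (f - g) ≤ max (yDeg f) (yDeg g) := by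
  simp only [yDeg_eq_natDegree, map_sub]
  exact Polynomial.natDegree_sub_le _ _

theorem yDeg_ofX (p : K[X]) : yDeg (ofX p) = 0 := by
  rw [yDeg_eq_natDegree, viewInY_ofX, Polynomial.natDegree_C]

theorem yDeg_X_pow (j : ℕ) : yDeg (X vy ^ j : MvPolynomial (Fin 2) K) = j := by
  rw [yDeg_eq_natDegree, map_pow, viewInY_X_vy, Polynomial.natDegree_X_pow]

theorem add_le_of_mem_support {f : MvPolynomial (Fin 2) K} {s : Fin 2 →₀ ℕ} (hs : s ∈ f.support) :
    s vx + s vy ≤ drlOrder.degree f vx + drlOrder.degree f vy := by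
  have h := drlOrder.le_degree hs
  rcases h.eq_or_lt with h | h
  · rw [drlOrder.toSyn.injective h]
  · rw [drlOrder_lt_iff] at h
    omega

variable {l : ℕ} {g : Fin l → MvPolynomial (Fin 2) K}

theorem exists_extendedBasis_eq {i : Fin l} {j : ℕ} (hj : j < blockSize g i) :
    ∃ r, extendedBasis g r = X vy ^ j * g i := by
  have h (p : (i : Fin l) × Fin (blockSize g i)) (hp : p = ⟨i, j, hj⟩) :
      X vy ^ (p.2 : ℕ) * g p.1 = X vy ^ j * g i := by rw [hp]
  exact ⟨finSigmaFinEquiv ⟨i, j, hj⟩, h _ (Equiv.symm_apply_apply _ _)⟩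

theorem exists_eq_extendedBasis (r : Fin (dim g)) :
    ∃ i, ∃ j < blockSize g i, extendedBasis g r = X vy ^ j * g i :=
  ⟨_, _, (finSigmaFinEquiv.symm r).2.2, rfl⟩

theorem blockSize_of_lt {i : Fin l} (h : (i : ℕ) + 1 < l) :
    blockSize g i = lmYDeg (g ⟨i + 1, h⟩) - lmYDeg (g i) := by
  rw [blockSize, dif_pos h, gap]

/-- The sum telescopes; sortedness keeps the natural number subtractions exact. -/
theorem sum_blockSize (hsort : Monotone fun i => lmYDeg (g i)) (m : ℕ) (hm : m < l) :
    ∑ i : Fin m, blockSize g ⟨i, i.2.trans hm⟩ + lmYDeg (g ⟨0, by omega⟩) =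
      lmYDeg (g ⟨m, hm⟩) := by
  induction m with
  | zero => simp
  | succ m ih =>
    have h1 : lmYDeg (g ⟨m, by omega⟩) ≤ lmYDeg (g ⟨m + 1, hm⟩) :=
      hsort (Fin.mk_le_mk.2 m.le_succ)
    have h2 := blockSize_of_lt (g := g) (i := ⟨m, by omega⟩) hm
    have h3 := ih (by omega)
    rw [Fin.sum_univ_castSucc]
    simp only [Fin.val_castSucc, Fin.val_last] at *
    omega

theorem dim_eq (hsort : Monotone fun i => lmYDeg (g i)) {i : Fin l} (hi : (i : ℕ) + 1 = l)
    {i₀ : Fin l} (h0 : lmYDeg (g i₀) = 0) : dim g = lmYDeg (g i) + blockSize g i := by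
  obtain ⟨i, hil⟩ := i
  obtain rfl : i + 1 = l := hi
  have h := sum_blockSize hsort i hil
  have hz : lmYDeg (g ⟨0, by omega⟩) = 0 :=
    Nat.le_zero.1 ((hsort (Fin.zero_le i₀)).trans_eq h0)
  rw [dim, Fin.sum_univ_castSucc]
  rw [hz, add_zero] at h
  exact congrArg₂ _ h rfl

theorem degree_vx_strictAnti (hinj : Function.Injective g)
    (hg : IsMinimalGroebnerBasis drlOrder I (Set.range g))
    (hsort : Monotone fun i => lmYDeg (g i)) :
    StrictAnti fun i => drlOrder.degree (g i) vx := by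
  intro i j hij
  by_contra! h
  exact hg.not_dvd _ ⟨j, rfl⟩ _ ⟨i, rfl⟩ (fun e => hij.ne' (hinj e))
    (exponent_le_iff.2 ⟨h, hsort hij.le⟩)

theorem exists_lmYDeg_eq_zero [Module.Finite K (MvPolynomial (Fin 2) K ⧸ I)]
    (hg : IsMinimalGroebnerBasis drlOrder I (Set.range g)) : ∃ i, lmYDeg (g i) = 0 := by
  obtain ⟨p, hp, hpI⟩ := exists_aeval_X_mem (I := I) vx
  have hne : ofX p ≠ 0 := fun h => hp (ofX_injective (by rw [h, map_zero]))
  obtain ⟨_, ⟨i, rfl⟩, -, h⟩ := hg.exists_degree_le hpI hne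
  refine ⟨i, Nat.le_zero.1 ((exponent_le_iff.1 h).2.trans ?_)⟩
  exact (le_yDeg (drlOrder.degree_mem_support hne)).trans_eq (yDeg_ofX p)

/-- `I` contains a nonzero polynomial in `y` alone, so some leading monomial is a power of `y`. As
the `x`-exponents strictly decrease along the basis, its index is the last one. -/
theorem exists_last [Module.Finite K (MvPolynomial (Fin 2) K ⧸ I)]
    (hinj : Function.Injective g) (hg : IsMinimalGroebnerBasis drlOrder I (Set.range g))
    (hsort : Monotone fun i => lmYDeg (g i)) :
    ∃ i : Fin l, (i : ℕ) + 1 = l ∧ drlOrder.degree (g i) vx = 0 := by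
  obtain ⟨p, hp, hpI⟩ := exists_aeval_X_mem (I := I) vy
  have hview : viewInY (Polynomial.aeval (X vy : MvPolynomial (Fin 2) K) p) =
      p.map Polynomial.C := by
    rw [← Polynomial.aeval_algHom_apply, viewInY_X_vy, Polynomial.aeval_X_left_eq_map]
    rfl
  have hne : Polynomial.aeval (X vy : MvPolynomial (Fin 2) K) p ≠ 0 := by
    intro h
    rw [h, map_zero, eq_comm, Polynomial.map_eq_zero_iff Polynomial.C_injective] at hview
    exact hp hview
  obtain ⟨_, ⟨i, rfl⟩, -, h⟩ := hg.exists_degree_le hpI hne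
  have hvx : drlOrder.degree (Polynomial.aeval (X vy : MvPolynomial (Fin 2) K) p) vx = 0 := by
    have hs := drlOrder.degree_mem_support hne
    rw [mem_support_iff, ← expo_eta (drlOrder.degree _), ← coeff_viewInY, hview,
      Polynomial.coeff_map, Polynomial.coeff_C] at hs
    by_contra h0
    exact hs (if_neg h0)
  have hi : drlOrder.degree (g i) vx = 0 := Nat.le_zero.1 ((exponent_le_iff.1 h).1.trans_eq hvx)
  refine ⟨i, ?_, hi⟩
  by_contra hl
  have := degree_vx_strictAnti hinj hg hsort
    (show i < ⟨i + 1, by omega⟩ from Fin.lt_def.2 (Nat.lt_succ_self _))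
  simp only [hi] at this
  omega

theorem yDeg_last {i : Fin l} (hi : drlOrder.degree (g i) vx = 0) :
    yDeg (g i) ≤ lmYDeg (g i) := by
  rw [yDeg, degreeOf_le_iff]
  intro s hs
  have := add_le_of_mem_support hs
  rw [lmYDeg]
  omega

theorem lmYDeg_le_yDeg (f : MvPolynomial (Fin 2) K) : lmYDeg f ≤ yDeg f := by
  by_cases hf : f = 0
  · simp [hf, lmYDeg]
  · exact le_yDeg (drlOrder.degree_mem_support hf)

/-- This is what the size of the last block is made for. The last leading monomial is a power of
`y`, so `dim g` equals `yDeg` of the last element plus the last block size, which is at least `n_i +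
yDeg (g i)` for every other `i`. -/
theorem yDeg_extendedBasis_lt [Module.Finite K (MvPolynomial (Fin 2) K ⧸ I)]
    (hinj : Function.Injective g) (hg : IsMinimalGroebnerBasis drlOrder I (Set.range g))
    (hsort : Monotone fun i => lmYDeg (g i)) (r : Fin (dim g)) :
    yDeg (extendedBasis g r) < dim g := by
  obtain ⟨i₀, h0⟩ := exists_lmYDeg_eq_zero hg
  obtain ⟨e, he, hx⟩ := exists_last hinj hg hsort
  have hdim := dim_eq hsort he h0
  have hye := yDeg_last hx
  obtain ⟨i, j, hj, hr⟩ := exists_eq_extendedBasis r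
  have hle := yDeg_mul_le (X vy ^ j) (g i)
  rw [yDeg_X_pow, ← hr] at hle
  by_cases hi : (i : ℕ) + 1 < l
  · have hbe : blockSize g e = max 1 ((Finset.univ.sup fun j : Fin l =>
        if hj : (j : ℕ) + 1 < l then gap g j hj + yDeg (g j) else 0) - yDeg (g e)) := by
      rw [blockSize, dif_neg (by omega)]
    have hsup := Finset.le_sup (f := fun j : Fin l =>
        if hj : (j : ℕ) + 1 < l then gap g j hj + yDeg (g j) else 0) (Finset.mem_univ i)
    simp only [dif_pos hi] at hsup
    rw [blockSize, dif_pos hi] at hj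
    omega
  · obtain rfl : i = e := Fin.ext (by omega)
    omega

theorem exists_block [Module.Finite K (MvPolynomial (Fin 2) K ⧸ I)]
    (hinj : Function.Injective g) (hg : IsMinimalGroebnerBasis drlOrder I (Set.range g))
    (hsort : Monotone fun i => lmYDeg (g i)) {b : ℕ} (hb : b < dim g) :
    ∃ i, lmYDeg (g i) ≤ b ∧ b - lmYDeg (g i) < blockSize g i ∧
      ∀ k, lmYDeg (g k) ≤ b → k ≤ i := by
  obtain ⟨i₀, h0⟩ := exists_lmYDeg_eq_zero hg
  obtain ⟨e, he, -⟩ := exists_last hinj hg hsort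
  have hdim := dim_eq hsort he h0
  have hne : (Finset.univ.filter fun k => lmYDeg (g k) ≤ b).Nonempty := ⟨i₀, by simp [h0]⟩
  obtain ⟨i, hi, hmax⟩ := Finset.exists_max_image _ id hne
  simp only [Finset.mem_filter, Finset.mem_univ, true_and, id] at hi hmax
  refine ⟨i, hi, ?_, hmax⟩
  by_cases hil : (i : ℕ) + 1 < l
  · rw [blockSize_of_lt hil]
    have : b < lmYDeg (g ⟨i + 1, hil⟩) := by
      by_contra! h
      have := Fin.le_def.1 (hmax _ h)
      simp at this
    omega
  · obtain rfl : i = e := Fin.ext (by omega)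
    omega

/-- Among the `g k` whose leading monomial has `y`-degree at most that of `f`, the last one has the
least `x`-exponent. A shift by a power of `y` within its block equalizes the `y`-degrees, leaving a
power of `x` as quotient. -/
theorem exists_extendedBasis_degree_le [Module.Finite K (MvPolynomial (Fin 2) K ⧸ I)]
    (hinj : Function.Injective g) (hg : IsMinimalGroebnerBasis drlOrder I (Set.range g))
    (hsort : Monotone fun i => lmYDeg (g i)) {f : MvPolynomial (Fin 2) K} (hf : f ∈ I)
    (hf0 : f ≠ 0) (hfy : yDeg f < dim g) :
    ∃ r, extendedBasis g r ≠ 0 ∧ drlOrder.degree (extendedBasis g r) ≤ drlOrder.degree f ∧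
      drlOrder.degree (extendedBasis g r) vy = drlOrder.degree f vy := by
  obtain ⟨i, hib, hj, hmax⟩ := exists_block hinj hg hsort ((lmYDeg_le_yDeg f).trans_lt hfy)
  obtain ⟨r, hr⟩ := exists_extendedBasis_eq hj
  obtain ⟨_, ⟨k, rfl⟩, -, hk⟩ := hg.exists_degree_le hf hf0
  have hki := hmax k (exponent_le_iff.1 hk).2
  have hx : drlOrder.degree (g i) vx ≤ drlOrder.degree f vx :=
    ((degree_vx_strictAnti hinj hg hsort).antitone hki).trans (exponent_le_iff.1 hk).1
  have hgi : g i ≠ 0 := fun h => hg.zero_notMem ⟨i, h⟩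
  have hX : (X vy ^ (lmYDeg f - lmYDeg (g i)) : MvPolynomial (Fin 2) K) ≠ 0 :=
    pow_ne_zero _ (X_ne_zero _)
  have hdeg : drlOrder.degree (extendedBasis g r) =
      Finsupp.single vy (lmYDeg f - lmYDeg (g i)) + drlOrder.degree (g i) := by
    rw [hr, MonomialOrder.degree_mul hX hgi, MonomialOrder.degree_pow, MonomialOrder.degree_X]
    simp
  have h1 : drlOrder.degree (extendedBasis g r) vx = drlOrder.degree (g i) vx := by
    rw [hdeg]; simp
  have h2 : drlOrder.degree (extendedBasis g r) vy = drlOrder.degree f vy := by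
    rw [hdeg]
    simp only [lmYDeg, Finsupp.add_apply, Finsupp.single_eq_same] at hib ⊢
    omega
  exact ⟨r, hr ▸ mul_ne_zero hX hgi, exponent_le_iff.2 ⟨h1 ▸ hx, h2.le⟩, h2⟩

theorem extendedBasis_mem (hg : IsMinimalGroebnerBasis drlOrder I (Set.range g))
    (r : Fin (dim g)) : extendedBasis g r ∈ I := by
  obtain ⟨i, j, -, hr⟩ := exists_eq_extendedBasis r
  rw [hr]
  exact I.mul_mem_left _ (hg.subset ⟨i, rfl⟩)

theorem exists_sum_extendedBasis [Module.Finite K (MvPolynomial (Fin 2) K ⧸ I)] (hI : I ≠ ⊤)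
    (hinj : Function.Injective g) (hg : IsMinimalGroebnerBasis drlOrder I (Set.range g))
    (hsort : Monotone fun i => lmYDeg (g i)) (d : drlOrder.syn) (f : MvPolynomial (Fin 2) K)
    (hf : f ∈ I) (hfy : yDeg f < dim g) (hd : drlOrder.toSyn (drlOrder.degree f) = d) :
    ∃ c : Fin (dim g) → K[X], f = ∑ r, ofX (c r) * extendedBasis g r := by
  induction d using WellFoundedLT.induction generalizing f with
  | ind d ih =>
    by_cases hf0 : f = 0
    · exact ⟨0, by simp [hf0]⟩
    obtain ⟨r, hr0, hle, hvy⟩ := exists_extendedBasis_degree_le hinj hg hsort hf hf0 hfy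
    set p := extendedBasis g r
    have hu : IsUnit (drlOrder.leadingCoeff p) :=
      isUnit_iff_ne_zero.2 (MonomialOrder.leadingCoeff_ne_zero_iff.2 hr0)
    have hlt := MonomialOrder.degree_reduce_lt hu hle (degree_ne_zero _ hI hf hf0)
    set q : K[X] := Polynomial.monomial (drlOrder.degree f vx - drlOrder.degree p vx)
      (hu.unit⁻¹ * drlOrder.leadingCoeff f) with hq
    -- The leading monomials of `f` and `p` have the same `y`-degree, so the multiplier lies in
    -- `K[x]` and the `y`-degree bound is preserved.
    have hred : drlOrder.reduce hu f = f - ofX q * p := by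
      rw [MonomialOrder.reduce, hq, ofX_monomial]
      congr 3
      rw [← expo_eta (drlOrder.degree f - drlOrder.degree p)]
      simp [hvy]
    rw [hred, hd] at hlt
    have hy : yDeg (f - ofX q * p) < dim g := by
      refine (yDeg_sub_le _ _).trans_lt (max_lt hfy ((yDeg_mul_le _ _).trans_lt ?_))
      rw [yDeg_ofX, zero_add]
      exact yDeg_extendedBasis_lt hinj hg hsort r
    obtain ⟨c, hc⟩ := ih _ hlt _ (I.sub_mem hf (I.mul_mem_left _ (extendedBasis_mem hg r))) hy rfl
    refine ⟨c + Pi.single r q, ?_⟩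
    have : ∑ i, ofX ((Pi.single r q : Fin (dim g) → K[X]) i) * extendedBasis g i = ofX q * p := by
      rw [Finset.sum_eq_single r (fun i _ hi => by simp [hi]) (by simp), Pi.single_eq_same]
    simp only [Pi.add_apply, map_add, add_mul, Finset.sum_add_distrib, this, ← hc]
    ring

/-- The rows of the block-Toeplitz matrix generate the `K[x]`-module of elements of `I` whose
degree in `y` is smaller than the size of the matrix. -/
theorem mem_rowModule_iff_toeplitzMatrix [Module.Finite K (MvPolynomial (Fin 2) K ⧸ I)]
    (hI : I ≠ ⊤) (hinj : Function.Injective g)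
    (hg : IsMinimalGroebnerBasis drlOrder I (Set.range g))
    (hsort : Monotone fun i => lmYDeg (g i)) (v : Fin (dim g) → K[X]) :
    v ∈ rowModule I (dim g) ↔ ∃ c, Matrix.vecMul c (toeplitzMatrix g) = v := by
  have hrow (r : Fin (dim g)) : rowPoly (toeplitzMatrix g r) = extendedBasis g r :=
    rowPoly_coeff_viewInY (yDeg_extendedBasis_lt hinj hg hsort r)
  rw [mem_rowModule]
  constructor
  · intro hv
    rcases Nat.eq_zero_or_pos (dim g) with h | h
    · exact ⟨0, funext fun k => absurd k.2 (by omega)⟩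
    obtain ⟨c, hc⟩ := exists_sum_extendedBasis hI hinj hg hsort _ _ hv (yDeg_rowPoly_lt v h) rfl
    refine ⟨c, rowPoly_injective ?_⟩
    rw [rowPoly_vecMul, hc]
    simp only [hrow]
  · rintro ⟨c, rfl⟩
    rw [rowPoly_vecMul]
    refine I.sum_mem fun r _ => I.mul_mem_left _ ?_
    rw [hrow]
    exact extendedBasis_mem hg r

theorem two_le_dim [Module.Finite K (MvPolynomial (Fin 2) K ⧸ I)]
    (hI : I ≠ ⊤) (hinj : Function.Injective g)
    (hg : IsMinimalGroebnerBasis drlOrder I (Set.range g))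
    (hsort : Monotone fun i => lmYDeg (g i)) : 2 ≤ dim g := by
  obtain ⟨i₀, h0⟩ := exists_lmYDeg_eq_zero hg
  obtain ⟨e, he, hx⟩ := exists_last hinj hg hsort
  have hdim := dim_eq hsort he h0
  have hb : 1 ≤ blockSize g e := by
    rw [blockSize, dif_neg (by omega)]
    exact le_max_left _ _
  have hd : lmYDeg (g e) ≠ 0 := fun h => by
    refine degree_ne_zero drlOrder hI (hg.subset ⟨e, rfl⟩) (fun h => hg.zero_notMem ⟨e, h⟩) ?_
    rw [← expo_eta (drlOrder.degree (g e)), hx, ← lmYDeg, h]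
    simp [expo]
  omega

theorem exists_monic_in_y [Module.Finite K (MvPolynomial (Fin 2) K ⧸ I)]
    (hinj : Function.Injective g) (hg : IsMinimalGroebnerBasis drlOrder I (Set.range g))
    (hsort : Monotone fun i => lmYDeg (g i)) :
    ∃ f ∈ I, yDeg f < dim g ∧ IsUnit ((viewInY f).coeff (yDeg f)) := by
  obtain ⟨i₀, h0⟩ := exists_lmYDeg_eq_zero hg
  obtain ⟨e, he, hx⟩ := exists_last hinj hg hsort
  have hdim := dim_eq hsort he h0
  have hb : 1 ≤ blockSize g e := by
    rw [blockSize, dif_neg (by omega)]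
    exact le_max_left _ _
  have hy : yDeg (g e) = lmYDeg (g e) := (yDeg_last hx).antisymm (lmYDeg_le_yDeg _)
  have hne : g e ≠ 0 := fun h => hg.zero_notMem ⟨e, h⟩
  refine ⟨g e, hg.subset ⟨e, rfl⟩, by omega, ?_⟩
  -- The leading monomial of `g e` is a power of `y` and the order is graded, so no positive power
  -- of `x` multiplies it.
  have hc : (viewInY (g e)).coeff (yDeg (g e)) =
      Polynomial.C ((g e).coeff (drlOrder.degree (g e))) := by
    ext a
    rw [coeff_viewInY, Polynomial.coeff_C]
    split_ifs with ha
    · rw [ha, ← hx, hy, lmYDeg, expo_eta]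
    · by_contra hs
      have := add_le_of_mem_support (mem_support_iff.2 hs)
      rw [expo_vx, expo_vy, hy, lmYDeg] at this
      omega
  rw [hc, Polynomial.isUnit_C, isUnit_iff_ne_zero]
  exact MonomialOrder.coeff_degree_ne_zero_iff.2 hne

end RowSpan

/-! ### Reading the reduced lexicographic Gröbner basis off the Hermite form. -/

section ReadOff

open Polynomial Matrix

variable {I : Ideal (MvPolynomial (Fin 2) K)} {n : ℕ} {H : Matrix (Fin n) (Fin n) K[X]}

/-- `H` is the Hermite normal form of the module of vectors of length `n` representing elements
of `I`. -/
structure IsHermiteOf (H : Matrix (Fin n) (Fin n) K[X]) (I : Ideal (MvPolynomial (Fin 2) K)) :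
    Prop extends IsHermite H where
  mem_iff : ∀ v, v ∈ rowModule I n ↔ ∃ c, c ᵥ* H = v

theorem IsHermiteOf.row_mem (hH : IsHermiteOf H I) (i : Fin n) : rowPoly (H i) ∈ I :=
  (hH.mem_iff (H i)).2 ⟨Pi.single i 1, by simp [Matrix.row]⟩

theorem IsHermiteOf.dvd_coeff (hH : IsHermiteOf H I) {f : MvPolynomial (Fin 2) K} (hf : f ∈ I)
    {b : Fin n} (hb : yDeg f ≤ b) : H b b ∣ (viewInY f).coeff b := by
  have hmem : (fun j : Fin n => (viewInY f).coeff j) ∈ rowModule I n := by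
    rw [mem_rowModule, rowPoly_coeff_viewInY (hb.trans_lt b.2)]
    exact hf
  obtain ⟨c, hc⟩ := (hH.mem_iff _).1 hmem
  have := hH.dvd_vecMul (c := c) (j := b) fun k hk => by
    rw [hc]
    rw [yDeg_eq_natDegree] at hb
    exact coeff_eq_zero_of_natDegree_lt (hb.trans_lt hk)
  rwa [hc] at this

theorem IsHermite.coeff_viewInY_row (i j : Fin n) :
    (viewInY (rowPoly (H i))).coeff j = H i j := by
  rw [coeff_viewInY_rowPoly, dif_pos j.2]

theorem IsHermite.yDeg_row (hH : IsHermite H) (i : Fin n) : yDeg (rowPoly (H i)) = i := by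
  rw [yDeg_eq_natDegree]
  refine natDegree_eq_of_le_of_coeff_ne_zero (natDegree_le_iff_coeff_eq_zero.2 fun j hj => ?_) ?_
  · rw [coeff_viewInY_rowPoly]
    split_ifs with h
    · exact hH.lower i ⟨j, h⟩ hj
    · rfl
  · rw [IsHermite.coeff_viewInY_row]
    exact (hH.monic i).ne_zero

/-- Each diagonal entry divides the previous ones. -/
theorem IsHermiteOf.diag_dvd (hH : IsHermiteOf H I) {i j : Fin n} (hij : i ≤ j) :
    H j j ∣ H i i := by
  have hij' : (i : ℕ) ≤ j := hij
  -- The shifted row lies in `I`, and its coefficient at `y^j` is `H i i`.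
  have hy : yDeg (MvPolynomial.X vy ^ (j - i : ℕ) * rowPoly (H i)) ≤ j := by
    refine (yDeg_mul_le _ _).trans ?_
    rw [yDeg_X_pow, hH.yDeg_row]
    omega
  have := hH.dvd_coeff (I.mul_mem_left _ (hH.row_mem i)) hy
  rwa [map_mul, map_pow, viewInY_X_vy, coeff_X_pow_mul', if_pos (Nat.sub_le _ _),
    Nat.sub_sub_self hij', IsHermite.coeff_viewInY_row] at this

theorem IsHermiteOf.natDegree_diag_le (hH : IsHermiteOf H I) {i j : Fin n} (hij : i ≤ j) :
    (H j j).natDegree ≤ (H i i).natDegree :=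
  natDegree_le_of_dvd (hH.diag_dvd hij) (hH.monic i).ne_zero

theorem IsHermite.degree_diag_lt_iff (hH : IsHermite H) {i j : Fin n} :
    (H i i).degree < (H j j).degree ↔ (H i i).natDegree < (H j j).natDegree := by
  rw [degree_eq_natDegree (hH.monic i).ne_zero, degree_eq_natDegree (hH.monic j).ne_zero,
    Nat.cast_lt]

theorem IsHermite.support_row (hH : IsHermite H) {i : Fin n} {s : Fin 2 →₀ ℕ}
    (hs : s ∈ (rowPoly (H i)).support) :
    (s vy = i ∧ s vx ≤ (H i i).natDegree) ∨
      ∃ j : Fin n, s vy = j ∧ j < i ∧ s vx < (H j j).natDegree := by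
  rw [MvPolynomial.mem_support_iff, coeff_rowPoly] at hs
  split_ifs at hs with h
  · rcases lt_trichotomy (⟨s vy, h⟩ : Fin n) i with hj | hj | hj
    · refine Or.inr ⟨_, rfl, hj, ?_⟩
      have := (le_degree_of_ne_zero hs).trans_lt (hH.degree_lt _ _ hj.ne')
      rwa [degree_eq_natDegree (hH.monic _).ne_zero, Nat.cast_lt] at this
    · subst hj
      exact Or.inl ⟨rfl, le_natDegree_of_ne_zero hs⟩
    · rw [hH.lower _ _ hj] at hs
      exact absurd (coeff_zero _) hs
  · exact absurd rfl hs

theorem IsHermite.coeff_row (hH : IsHermite H) (i : Fin n) :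
    (rowPoly (H i)).coeff (expo (H i i).natDegree i) = 1 := by
  rw [← coeff_viewInY, IsHermite.coeff_viewInY_row]
  exact hH.monic i

theorem IsHermite.lexDegree_row (hH : IsHermite H) (i : Fin n) :
    lexOrder.degree (rowPoly (H i)) = expo (H i i).natDegree i := by
  apply lexOrder.toSyn.injective
  apply le_antisymm
  · rw [MonomialOrder.degree_le_iff]
    intro s hs
    by_contra! hlt
    rw [lexOrder_lt_iff, expo_vx, expo_vy] at hlt
    rcases hH.support_row hs with h | ⟨j, h1, h2, -⟩
    · omega
    · have : (j : ℕ) < i := h2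
      omega
  · apply MonomialOrder.le_degree
    rw [MvPolynomial.mem_support_iff, hH.coeff_row]
    exact one_ne_zero

theorem IsHermite.lexMonic_row (hH : IsHermite H) (i : Fin n) :
    lexOrder.Monic (rowPoly (H i)) := by
  rw [MonomialOrder.Monic, MonomialOrder.leadingCoeff, hH.lexDegree_row, hH.coeff_row]

/-- The first row with the same diagonal degree as row `i` is selected, since degrees never increase
down the diagonal. -/
theorem IsHermiteOf.exists_mem_readOff (hH : IsHermiteOf H I) (i : Fin n) :
    ∃ k ≤ i, (H k k).natDegree = (H i i).natDegree ∧ rowPoly (H k) ∈ readOff H := by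
  classical
  have hne : (Finset.univ.filter fun k => (H k k).natDegree = (H i i).natDegree).Nonempty :=
    ⟨i, by simp⟩
  obtain ⟨k, hk, hmin⟩ := Finset.exists_min_image _ id hne
  simp only [Finset.mem_filter, Finset.mem_univ, true_and, id] at hk hmin
  refine ⟨k, hmin i rfl, hk, k, fun j hj => ?_, rfl⟩
  rw [hH.degree_diag_lt_iff]
  refine lt_of_le_of_ne (hH.natDegree_diag_le (Fin.le_def.2 (by omega))) fun h => ?_
  have := Fin.le_def.1 (hmin j (h ▸ hk))
  omega

theorem IsHermiteOf.natDegree_lt_of_selected (hH : IsHermiteOf H I) {i j : Fin n} (hji : j < i)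
    (hi : ∀ k : Fin n, (k : ℕ) + 1 = i → (H i i).degree < (H k k).degree) :
    (H i i).natDegree < (H j j).natDegree := by
  have hji' : (j : ℕ) < i := hji
  let k : Fin n := ⟨i - 1, by omega⟩
  have hk := hH.degree_diag_lt_iff.1 (hi k (by simp [k]; omega))
  exact hk.trans_le (hH.natDegree_diag_le (Fin.le_def.2 (by simp [k]; omega)))

/-- The polynomials read off from the Hermite form are the reduced lexicographic Gröbner basis,
as soon as some element of `I` of degree less than `n` in `y` has leading coefficient a unit. -/
theorem IsHermiteOf.isReducedGroebnerBasis_readOff (hH : IsHermiteOf H I)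
    (hI : ∃ f ∈ I, yDeg f < n ∧ IsUnit ((viewInY f).coeff (yDeg f))) :
    IsReducedGroebnerBasis lexOrder I (readOff H) := by
  have hmonic : ∀ p ∈ readOff H, lexOrder.Monic p := by
    rintro _ ⟨i, -, rfl⟩
    exact hH.lexMonic_row i
  refine ⟨isGroebnerBasis_of_exists_degree_le ?_ ?_ hmonic ?_, hmonic, ?_⟩
  · refine (Set.finite_range fun i => rowPoly (H i)).subset ?_
    rintro _ ⟨i, -, rfl⟩
    exact ⟨i, rfl⟩
  · rintro _ ⟨i, -, rfl⟩
    exact hH.row_mem i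
  · intro f hf hf0
    set s := lexOrder.degree f
    have hcs : f.coeff s ≠ 0 := MonomialOrder.coeff_degree_ne_zero_iff.2 hf0
    have hy : yDeg f ≤ s vy := by
      rw [yDeg, MvPolynomial.degreeOf_le_iff]
      intro t ht
      by_contra! hlt
      exact absurd (lexOrder.le_degree ht) (not_le.2 ((lexOrder_lt_iff _ _).2 (Or.inl hlt)))
    -- For `s vy < n`, the diagonal entry divides the leading coefficient of `f` in `y`, which has
    -- degree at most `s vx`. Otherwise the given element with unit leading coefficient yields a
    -- diagonal entry of degree `0`.
    obtain ⟨i, his, hix⟩ : ∃ i : Fin n, (i : ℕ) ≤ s vy ∧ (H i i).natDegree ≤ s vx := by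
      by_cases hn : s vy < n
      · refine ⟨⟨s vy, hn⟩, le_rfl, ?_⟩
        have hdvd := hH.dvd_coeff (b := ⟨s vy, hn⟩) hf hy
        have hc : ((viewInY f).coeff (s vy)).coeff (s vx) ≠ 0 := by
          rwa [coeff_viewInY, expo_eta]
        refine (natDegree_le_of_dvd hdvd fun h => hc (by rw [h, coeff_zero])).trans ?_
        rw [natDegree_le_iff_coeff_eq_zero]
        intro a ha
        rw [coeff_viewInY]
        apply MonomialOrder.coeff_eq_zero_of_lt (m := lexOrder)
        rw [lexOrder_lt_iff, expo_vx, expo_vy]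
        exact Or.inr ⟨rfl, ha⟩
      · obtain ⟨q, hq, hqn, hu⟩ := hI
        refine ⟨⟨yDeg q, hqn⟩, by simp; omega, ?_⟩
        have := isUnit_of_dvd_unit (hH.dvd_coeff (b := ⟨yDeg q, hqn⟩) hq le_rfl) hu
        rw [natDegree_eq_zero_of_isUnit this]
        exact Nat.zero_le _
    obtain ⟨k, hki, hkd, hk⟩ := hH.exists_mem_readOff i
    have hki : (k : ℕ) ≤ i := hki
    refine ⟨_, hk, ?_⟩
    rw [hH.lexDegree_row, exponent_le_iff, expo_vx, expo_vy]
    omega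
  · rintro _ ⟨i, hi, rfl⟩ _ ⟨k, hk, rfl⟩ hne s hs hle
    have hik : i ≠ k := fun h => hne (by rw [h])
    rw [hH.lexDegree_row, exponent_le_iff, expo_vx, expo_vy] at hle
    -- In the diagonal column, divisibility is excluded by the degree drop at row `i`. In a column
    -- `j < i`, it would give `k ≤ j`, and the exponent of `x` is below `deg H j j ≤ deg H k k`.
    rcases hH.support_row hs with ⟨h1, h2⟩ | ⟨j, h1, h2, h3⟩
    · have hki : k < i := lt_of_le_of_ne (Fin.le_def.2 (by omega)) hik.symm
      have := hH.natDegree_lt_of_selected hki hi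
      omega
    · have := hH.natDegree_diag_le (i := k) (j := j) (Fin.le_def.2 (by omega))
      omega

theorem IsHermite.readOff_submatrix (hH : IsHermite H) {m : ℕ} (hm : m ≤ n) :
    readOff (H.submatrix (Fin.castLE hm) (Fin.castLE hm)) = {p ∈ readOff H | yDeg p < m} := by
  have hrow (i : Fin m) : rowPoly (H.submatrix (Fin.castLE hm) (Fin.castLE hm) i) =
      rowPoly (H (Fin.castLE hm i)) := by
    apply viewInY_injective
    ext1 j
    rw [coeff_viewInY_rowPoly, coeff_viewInY_rowPoly]
    by_cases hj : j < m
    · rw [dif_pos hj, dif_pos (hj.trans_le hm)]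
      rfl
    · rw [dif_neg hj]
      split_ifs with h
      · exact (hH.lower _ _ (Fin.lt_def.2 (by simp; omega))).symm
      · rfl
  ext p
  constructor
  · rintro ⟨i, hi, rfl⟩
    rw [hrow]
    refine ⟨⟨Fin.castLE hm i, fun k hk => ?_, rfl⟩, ?_⟩
    · simp only [Fin.val_castLE] at hk
      exact hi ⟨k, by omega⟩ hk
    · rw [hH.yDeg_row]
      exact i.2
  · rintro ⟨⟨i, hi, rfl⟩, hlt⟩
    rw [hH.yDeg_row] at hlt
    refine ⟨⟨i, hlt⟩, fun k hk => hi (Fin.castLE hm k) hk, ?_⟩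
    rw [hrow]
    rfl

end ReadOff

/-! ### Shape position and the generic row-HNF property. -/

section Shape

open Polynomial Matrix

variable {I : Ideal (MvPolynomial (Fin 2) K)} {n : ℕ} {H M : Matrix (Fin n) (Fin n) K[X]}

/-- Since `y` is congruent to `f₁(x)`, the map from `K[x]` to the quotient is surjective, and its
kernel is generated by `f₀`. -/
theorem finrank_quotient_of_shape {f₀ f₁ : K[X]} (h0 : ∀ p, ofX p ∈ I ↔ f₀ ∣ p)
    (h1 : MvPolynomial.X vy - ofX f₁ ∈ I) :
    Module.finrank K (MvPolynomial (Fin 2) K ⧸ I) = f₀.natDegree := by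
  let φ : K[X] →ₐ[K] MvPolynomial (Fin 2) K ⧸ I := (Ideal.Quotient.mkₐ K I).comp ofX
  let ψ : MvPolynomial (Fin 2) K →ₐ[K] K[X] := MvPolynomial.aeval ![f₁, X]
  have hcomp : φ.comp ψ = Ideal.Quotient.mkₐ K I := by
    apply MvPolynomial.algHom_ext
    intro i
    fin_cases i
    · simpa [φ, ψ] using (Ideal.Quotient.eq.2 h1).symm
    · simp [φ, ψ, ofX]
  have hsurj : Function.Surjective φ := fun q => by
    obtain ⟨p, rfl⟩ := Ideal.Quotient.mkₐ_surjective K I q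
    exact ⟨ψ p, DFunLike.congr_fun hcomp p⟩
  have hker : RingHom.ker φ = Ideal.span {f₀} := by
    ext p
    rw [RingHom.mem_ker, Ideal.mem_span_singleton, ← h0]
    exact Ideal.Quotient.eq_zero_iff_mem
  rw [← finrank_quotient_span_eq_natDegree, ← hker]
  exact (Ideal.quotientKerAlgEquivOfSurjective hsurj).toLinearEquiv.finrank_eq.symm

theorem IsHermite.rowPoly_zero (hH : IsHermite H) (hn : 0 < n) :
    rowPoly (H ⟨0, hn⟩) = ofX (H ⟨0, hn⟩ ⟨0, hn⟩) := by
  apply viewInY_injective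
  ext1 j
  rw [coeff_viewInY_rowPoly, viewInY_ofX, coeff_C]
  split_ifs with h h' h'
  · subst h'; rfl
  · exact hH.lower _ _ (Fin.lt_def.2 (Nat.pos_of_ne_zero h'))
  · omega
  · rfl

theorem IsHermiteOf.ofX_mem_iff (hH : IsHermiteOf H I) (hn : 0 < n) (p : K[X]) :
    ofX p ∈ I ↔ H ⟨0, hn⟩ ⟨0, hn⟩ ∣ p := by
  constructor
  · intro hp
    have := hH.dvd_coeff (b := ⟨0, hn⟩) hp (yDeg_ofX p).le
    rwa [viewInY_ofX, coeff_C_zero] at this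
  · rintro ⟨q, rfl⟩
    rw [map_mul, ← hH.rowPoly_zero hn]
    exact I.mul_mem_right _ (hH.row_mem _)

theorem IsHermite.apply_eq_one (hH : IsHermite H) {j : Fin n} (hj : H j j = 1) (i : Fin n) :
    H i j = (1 : Matrix (Fin n) (Fin n) K[X]) i j := by
  by_cases hij : i = j
  · rw [hij, hj, one_apply_eq]
  · have := hH.degree_lt i j hij
    rw [hj, degree_one] at this
    rw [one_apply_ne hij]
    exact degree_eq_bot.1 (Nat.WithBot.lt_zero_iff.1 this)

theorem rowPoly_eq_of_generic (hn : 1 < n) {v : Fin n → K[X]}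
    (hv : ∀ j : Fin n, (j : ℕ) ≠ 0 → v j = (1 : Matrix (Fin n) (Fin n) K[X]) ⟨1, hn⟩ j) :
    rowPoly v = MvPolynomial.X vy - ofX (-v ⟨0, by omega⟩) := by
  apply viewInY_injective
  ext1 j
  rw [coeff_viewInY_rowPoly, map_sub, viewInY_ofX, viewInY_X_vy, coeff_sub, coeff_X, coeff_C]
  split_ifs with h h1 h2 h2 h1 h2 h2
  all_goals first | omega | skip
  · rw [hv _ (by simp; omega)]
    subst h1
    simp
  · subst h2; simp
  · rw [hv _ h2, one_apply_ne (by simpa [Fin.ext_iff] using h1)]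
    simp
  · simp

theorem IsHermiteOf.isShapePosition_iff (hH : IsHermiteOf H I) (hI : I ≠ ⊤)
    (hu : ∃ f ∈ I, yDeg f < n ∧ IsUnit ((viewInY f).coeff (yDeg f))) (hn : 1 < n) :
    IsShapePosition I ↔ H ⟨1, hn⟩ ⟨1, hn⟩ = 1 := by
  constructor
  · rintro ⟨f₀, f₁, -, -, hG⟩
    have hmem : MvPolynomial.X vy - ofX f₁ ∈ I := hG.subset (by simp)
    have hy : yDeg (MvPolynomial.X vy - ofX f₁) ≤ 1 := by
      refine (yDeg_sub_le _ _).trans (max_le ?_ ?_)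
      · simpa using (yDeg_X_pow (K := K) 1).le
      · rw [yDeg_ofX]; omega
    have := hH.dvd_coeff (b := ⟨1, hn⟩) hmem hy
    rw [map_sub, viewInY_X_vy, viewInY_ofX, coeff_sub, coeff_X_one, coeff_C_of_ne_zero one_ne_zero,
      sub_zero] at this
    exact (hH.monic _).eq_one_of_isUnit (isUnit_of_dvd_one this)
  · intro h1
    let z : Fin n := ⟨0, by omega⟩
    let o : Fin n := ⟨1, hn⟩
    have hrow1 : rowPoly (H o) = MvPolynomial.X vy - ofX (-H o z) := by
      refine rowPoly_eq_of_generic hn fun j hj => hH.apply_eq_one ?_ o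
      refine (hH.monic _).eq_one_of_isUnit (isUnit_of_dvd_one ?_)
      rw [← h1]
      -- All diagonal entries after the first divide `H 1 1 = 1`, so their columns are those of the
      -- identity.
      exact hH.diag_dvd (Fin.le_def.2 (by simp; omega))
    have hmem : MvPolynomial.X vy - ofX (-H o z) ∈ I := hrow1 ▸ hH.row_mem o
    have h0 := hH.ofX_mem_iff (by omega : 0 < n)
    have hD := finrank_quotient_of_shape h0 hmem
    have hdeg : (H z z).degree = (Module.finrank K (MvPolynomial (Fin 2) K ⧸ I) : ℕ) := by
      rw [hD, degree_eq_natDegree (hH.monic z).ne_zero]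
    refine ⟨H z z, -H o z, hdeg, ?_, ?_⟩
    · rw [← hdeg, degree_neg]
      exact hH.degree_lt o z (by simp [o, z])
    · convert hH.isReducedGroebnerBasis_readOff hu using 1
      have hrow0 : rowPoly (H z) = ofX (H z z) := hH.rowPoly_zero _
      -- Properness of `I` makes the degree drop from row `0` to row `1`, so that row `1` is
      -- selected.
      have hz : (H z z).natDegree ≠ 0 := fun h => by
        have : H z z = 1 := (hH.monic z).natDegree_eq_zero.1 h
        have h1 := hH.row_mem z
        rw [hrow0, this, map_one] at h1
        exact hI (I.eq_top_iff_one.2 h1)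
      rw [← hrow0, ← hrow1]
      ext p
      constructor
      · rintro (rfl | rfl)
        · exact ⟨z, fun k hk => by simp [z] at hk, rfl⟩
        · refine ⟨o, fun k hk => ?_, rfl⟩
          obtain rfl : k = z := Fin.ext (by simpa [o] using hk)
          rw [hH.degree_diag_lt_iff, show H o o = 1 from h1, natDegree_one]
          omega
      · rintro ⟨i, hi, rfl⟩
        rcases lt_or_ge (1 : ℕ) i with h | h
        · have h2 := hH.natDegree_lt_of_selected (j := o) (i := i) (Fin.lt_def.2 h) hi
          rw [show H o o = 1 from h1, natDegree_one] at h2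
          omega
        · rcases Nat.le_one_iff_eq_zero_or_eq_one.1 h with h | h
          · obtain rfl : i = z := Fin.ext h
            exact Or.inl rfl
          · obtain rfl : i = o := Fin.ext h
            exact Or.inr rfl

/-- Row `1` of a generic form represents some `y - f₁(x)` in `I`, which forces `H 1 1 = 1`.
Conversely, all later diagonal entries are then `1`, so `H` itself is generic. -/
theorem IsHermiteOf.genericRowHermite_iff (hH : IsHermiteOf H I) (hHM : IsHermiteFormOf H M)
    (hM : ∀ v, v ∈ rowModule I n ↔ ∃ c, c ᵥ* M = v) (hn : 1 < n) :
    GenericRowHermite M ↔ H ⟨1, hn⟩ ⟨1, hn⟩ = 1 := by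
  constructor
  · rintro ⟨U, -, h⟩
    have hmem : rowPoly ((U * M) ⟨1, hn⟩) ∈ I := (hM _).2 ⟨U ⟨1, hn⟩, rfl⟩
    have hrow := rowPoly_eq_of_generic hn (fun j hj => h ⟨1, hn⟩ j hj)
    have hy : yDeg (rowPoly ((U * M) ⟨1, hn⟩)) ≤ 1 := by
      rw [hrow]
      refine (yDeg_sub_le _ _).trans (max_le ?_ ?_)
      · simpa using (yDeg_X_pow (K := K) 1).le
      · rw [yDeg_ofX]; omega
    have := hH.dvd_coeff (b := ⟨1, hn⟩) hmem hy
    rw [IsHermite.coeff_viewInY_row, h _ _ one_ne_zero, one_apply_eq] at this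
    exact (hH.monic _).eq_one_of_isUnit (isUnit_of_dvd_one this)
  · intro h1
    obtain ⟨-, U, hU, e⟩ := hHM
    refine ⟨U, hU, fun i j hj => ?_⟩
    rw [← e]
    refine hH.apply_eq_one ((hH.monic _).eq_one_of_isUnit (isUnit_of_dvd_one ?_)) i
    rw [← h1]
    exact hH.diag_dvd (Fin.le_def.2 (by simp; omega))

theorem exists_isHermiteOf [Module.Finite K (MvPolynomial (Fin 2) K ⧸ I)] (n : ℕ) :
    ∃ H : Matrix (Fin n) (Fin n) K[X], IsHermiteOf H I := by
  obtain ⟨p, hp, hpI⟩ := exists_aeval_X_mem (I := I) vx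
  obtain ⟨H, hH, h⟩ := exists_isHermite (rowModule I n) fun j => by
    -- For a nonzero `p(x)` in `I`, the multiples `p(x) y^j` provide a nonzero pivot in every
    -- column.
    refine ⟨Pi.single j p, ?_, fun k hk => Pi.single_eq_of_ne hk.ne' _, by simpa using hp⟩
    have : rowPoly (Pi.single j p : Fin n → K[X]) = ofX p * MvPolynomial.X vy ^ (j : ℕ) := by
      rw [rowPoly, Finset.sum_eq_single j (fun i _ hi => by simp [hi]) (by simp),
        Pi.single_eq_same]
    rw [mem_rowModule, this]
    exact I.mul_mem_right _ hpI
  exact ⟨H, hH, h⟩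

end Shape

end LexFromHermite

theorem mainTheorem3 {K : Type*} [Field K] (I : Ideal (MvPolynomial (Fin 2) K))
    (hI : I ≠ ⊤) (hfin : Module.Finite K (MvPolynomial (Fin 2) K ⧸ I))
    {l : ℕ} (g : Fin l → MvPolynomial (Fin 2) K) (hinj : Function.Injective g)
    (hg : IsMinimalGroebnerBasis drlOrder I (Set.range g))
    (hsort : Monotone fun i => lmYDeg (g i)) :
    (∃! H : Matrix (Fin (dim g)) (Fin (dim g)) (Polynomial K),
      IsHermiteFormOf H (toeplitzMatrix g)) ∧
    (∃! G : Set (MvPolynomial (Fin 2) K), IsReducedGroebnerBasis lexOrder I G) ∧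
    (∀ (H : Matrix (Fin (dim g)) (Fin (dim g)) (Polynomial K))
      (G : Set (MvPolynomial (Fin 2) K)),
      IsHermiteFormOf H (toeplitzMatrix g) → IsReducedGroebnerBasis lexOrder I G →
      ∀ (m : ℕ) (_ : 1 ≤ m) (hm : m ≤ dim g),
        {p ∈ G | yDeg p < m} = readOff (H.submatrix (Fin.castLE hm) (Fin.castLE hm))) ∧
    (IsShapePosition I ↔ GenericRowHermite (toeplitzMatrix g)) := by
  have hM := mem_rowModule_iff_toeplitzMatrix hI hinj hg hsort
  have hu := exists_monic_in_y hinj hg hsort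
  have hn := two_le_dim hI hinj hg hsort
  obtain ⟨H, hH⟩ := exists_isHermiteOf (I := I) (dim g)
  have hHM : IsHermiteFormOf H (toeplitzMatrix g) :=
    isHermiteFormOf_iff.2 ⟨hH.toIsHermite, fun v => (hM v).symm.trans (hH.mem_iff v)⟩
  have hG := hH.isReducedGroebnerBasis_readOff hu
  refine ⟨⟨H, hHM, fun H' h => h.unique hHM⟩, ⟨_, hG, fun G' h => h.unique hG⟩, ?_, ?_⟩
  · intro H' G hH' hG' m _ hm
    rw [hH'.unique hHM, hG'.unique hG, hH.readOff_submatrix hm]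
  · rw [hH.isShapePosition_iff hI hu hn, hH.genericRowHermite_iff hHM hM hn]
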